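/- Let $\alpha=(\alpha_1\ge\dots\ge\alpha_\ell)$ be a partition with all parts $\alpha_j\ge 2$, let $\pi$ be a permutation of $\{1,\dots,\ell\}$, and let $\alpha_\pi=(\alpha_{\pi(1)},\dots,\alpha_{\pi(\ell)})$. Let $R_{\alpha_\pi}$ be the connected ribbon whose row lengths from top to bottom are the entries of $\alpha_\pi$ (so that any two consecutive rows share exactly one column). The overlapping partition $p^\pi=(p^\pi_1,\dots,p^\pi_\ell)$ of $R_{\alpha_\pi}$ is defined by letting $p^\pi_i$, for $1\le i\le\ell$, be the number of columns of length two in the diagram formed by the $\ell-i+1$ smallest rows of $R_{\alpha_\pi}$ in lowest position, that is, the rows that remain when the $i-1$ longest rows are deleted, where among rows of equal length the highest is deleted first; $\ell(p^\pi)$ is the number of its nonzero entries. For a partition $\nu$ let $c^\nu_{R_{\alpha_\pi}}$ be the Littlewood--Richardson coefficient of $R_{\alpha_\pi}$, that is, the coefficient of the Schur function $s_\nu$ in the expansion of the skew Schur function $s_{R_{\alpha_\pi}}$ in the basis of Schur functions. If $c^\nu_{R_{\alpha_\pi}}>0$, then $$\nu_i\le\sum_{q=i}^{\ell}\alpha_q-p^\pi_i\qquad\text{for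 all }1\le i\le\ell(p^\pi),$$ where $\nu_i=0$ if $i$ exceeds the number of parts of $\nu$. -/

import Mathlib

/-- A filling `T` of a finite set `D` of boxes is semistandard if its entries increase weakly along
rows (left to right) and strictly down columns. A box `(i, j)` lies in row `i` and column `j`; rows
are numbered downwards and columns rightwards, from `0`. As for Mathlib's
`SemistandardYoungTableau`, the alphabet is `ℕ`, the letter `k` playing the role of the positive
integer `k + 1`. -/
def IsSemistandard {D : Finset (ℕ × ℕ)} (T : D → ℕ) : Prop :=
  (∀ c d : D, c.1.1 = d.1.1 → c.1.2 < d.1.2 → T c ≤ T d) ∧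
  (∀ c d : D, c.1.2 = d.1.2 → c.1.1 < d.1.1 → T c < T d)

/-- The content of a filling: `content T k` is the number of boxes with entry `k`. -/
noncomputable def content {D : Finset (ℕ × ℕ)} (T : D → ℕ) : ℕ →₀ ℕ :=
  ∑ c : D, Finsupp.single (T c) 1

/-- The (skew) Schur function `∑_T x^T`, the sum over all semistandard fillings `T` of the (skew)
shape `D`, as a formal power series in the variables `x₀, x₁, x₂, …`: the coefficient of a monomial
is the number of semistandard fillings with that content. -/
noncomputable def schurFunction (D : Finset (ℕ × ℕ)) : MvPowerSeries ℕ ℚ :=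
  fun γ => (Nat.card {T : D → ℕ // IsSemistandard T ∧ content T = γ} : ℚ)

/-- `c` is the family of coefficients in an expansion `f = ∑_ν c_ν s_ν` of `f` as a finite linear
combination of the Schur functions of partitions (Young diagrams) `ν`. -/
def IsSchurExpansion (f : MvPowerSeries ℕ ℚ) (c : YoungDiagram →₀ ℚ) : Prop :=
  f = c.sum fun ν a => a • schurFunction ν.cells

open Classical in
/-- The coefficient of `s_ν` in the expansion of `f` in the basis of Schur functions
(and `0` if `f` is not a linear combination of Schur functions). -/
noncomputable def schurCoeff (f : MvPowerSeries ℕ ℚ) (ν : YoungDiagram) : ℚ :=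
  if h : ∃ c, IsSchurExpansion f c then h.choose ν else 0

/-- The Littlewood-Richardson coefficient `c_A^ν` of a skew shape `A`: the coefficient of `s_ν`
in the expansion of the skew Schur function `s_A` in the basis of Schur functions. -/
noncomputable def lrCoeff (A : Finset (ℕ × ℕ)) (ν : YoungDiagram) : ℚ :=
  schurCoeff (schurFunction A) ν

/-- The first column of row `r` in the connected ribbon with row lengths `β`: the bottom row starts
in column `0`, and every other row starts in the last column of the row just below it. -/
def ribbonStart {l : ℕ} (β : Fin l → ℕ) (r : Fin l) : ℕ :=
  ∑ q ∈ Finset.Ioi r, (β q - 1)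

/-- Row `r` of the connected ribbon with row lengths `β`. -/
def ribbonRow {l : ℕ} (β : Fin l → ℕ) (r : Fin l) : Finset (ℕ × ℕ) :=
  (Finset.range (β r)).image fun j => ((r : ℕ), ribbonStart β r + j)

/-- The connected ribbon `R_β` whose row lengths, from top to bottom, are the (positive) parts of
the composition `β`; consecutive rows overlap in exactly one column. -/
def connectedRibbon {l : ℕ} (β : Fin l → ℕ) : Finset (ℕ × ℕ) :=
  Finset.univ.biUnion (ribbonRow β)

/-- The rows of the ribbon listed before row `r` when the rows are put in decreasing length order,
rows of equal length being listed from top to bottom. -/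
def longerRows {l : ℕ} (β : Fin l → ℕ) (r : Fin l) : Finset (Fin l) :=
  {s | β r < β s ∨ (β s = β r ∧ s < r)}

/-- The rows that remain when the `i` longest rows are removed (among rows of equal length, the
highest is removed first): the `l - i` smallest rows, in lowest position. -/
def smallestRows {l : ℕ} (β : Fin l → ℕ) (i : ℕ) : Finset (Fin l) :=
  {r | i ≤ (longerRows β r).card}

/-- The number of columns of length two of a diagram. -/
def numColumnsTwo (D : Finset (ℕ × ℕ)) : ℕ :=
  ((D.image Prod.snd).filter fun j => (D.filter fun c => c.2 = j).card = 2).card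

/-- The overlapping partition of the connected ribbon `R_β`, for `β` with parts at least two.
With indices starting from `0`, the entry `i` is the number of columns of length two among the
`l - i` smallest rows of `R_β`, in lowest position. -/
def overlappingPartition {l : ℕ} (β : Fin l → ℕ) (i : Fin l) : ℕ :=
  numColumnsTwo ((smallestRows β i).biUnion (ribbonRow β))

/-- The length of a partition written with trailing zeros: the number of its nonzero entries. -/
def partitionLength {l : ℕ} (p : Fin l → ℕ) : ℕ :=
  (Finset.univ.filter fun i => p i ≠ 0).card

/-! A positive Littlewood-Richardson coefficient gives a semistandard filling of the ribbon with
content `ν` that is good: for every `j`, the columns `≥ j` have partition content. It then suffices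
to bound the number `ν_i` of letters `i` in a good filling (letters and indices from `0`).

For the existence, the functional `alternatingCoeff`, `f ↦ ∑_w sgn(w) [x^{w(ν+δ)-δ}] f`, is applied
to a skew Schur function. A sign-reversing involution takes the rightmost bad column `j` and
performs a Bender-Knuth move on the columns `< j`; it cancels everything but the good fillings with
content `ν` (`sum_sign_eq_card_good`). A straight shape `μ` has only one good filling that can
occur, the one with all letters `r` in row `r`, so on the functions `s_μ` the functional is `1` for
`μ = ν` and `0` otherwise. Hence it reads off the coefficient of `s_ν`
(`exists_good_of_lrCoeff_pos`).

For the bound, a good filling has at most as many letters `k + 1` in rows `0, …, r` as letters `k`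
in rows `0, …, r - 1` (`IsGood.letterCount_succ_le_letterCount`). Scan the ribbon downwards and
follow the letter `m`, where `m` is the number of deleted rows met so far. A deleted row raises `m`
by one and costs nothing by this inequality; a kept row adds at most the number of its new columns,
because a column holds no letter twice and an overlap can be charged to the row above
(`IsGood.letterCount_le_sum_newColumns`). After deleting the `i` longest rows, the remaining ones
have `∑_{q ≥ i} α_q - p_i` columns. -/

/-! ### Semistandard fillings as Gelfand-Tsetlin patterns. -/

/-- `D` is a skew shape: its row `r` occupies the columns `lo r ≤ c < hi r`, and only the rows
`r < R` can be non-empty. -/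
structure IsSkewShape (D : Finset (ℕ × ℕ)) (lo hi : ℕ → ℕ) (R : ℕ) : Prop where
  mem_iff : ∀ r c, (r, c) ∈ D ↔ lo r ≤ c ∧ c < hi r
  lo_anti : Antitone lo
  hi_anti : Antitone hi
  lo_le_hi : ∀ r, lo r ≤ hi r
  hi_eq_zero : ∀ r, R ≤ r → hi r = 0

/-- Gelfand-Tsetlin patterns of a skew shape: `b r k` is the first column of row `r`, counted from
`lo r`, whose entry is at least `k` in the corresponding semistandard filling with letters
`0, …, n - 1`. -/
structure IsGTPattern (lo hi : ℕ → ℕ) (n : ℕ) (b : ℕ → ℕ → ℕ) : Prop where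
  zero : ∀ r, b r 0 = lo r
  top : ∀ r k, n ≤ k → b r k = hi r
  le_succ : ∀ r k, b r k ≤ b r (k + 1)
  succ_le : ∀ r k, b (r + 1) (k + 1) ≤ b r k

/-- The number of letters `k` in the filling given by a pattern with `R` rows. -/
def letterCount (R : ℕ) (b : ℕ → ℕ → ℕ) (k : ℕ) : ℤ :=
  ∑ r ∈ Finset.range R, ((b r (k + 1) : ℤ) - b r k)

namespace IsGTPattern

variable {lo hi : ℕ → ℕ} {n : ℕ} {b : ℕ → ℕ → ℕ}

theorem mono (hb : IsGTPattern lo hi n b) (r : ℕ) : Monotone (b r) :=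
  monotone_nat_of_le_succ (hb.le_succ r)

theorem lo_le (hb : IsGTPattern lo hi n b) (r k : ℕ) : lo r ≤ b r k :=
  hb.zero r ▸ hb.mono r (Nat.zero_le k)

theorem le_hi (hb : IsGTPattern lo hi n b) (r k : ℕ) : b r k ≤ hi r :=
  (hb.mono r (le_max_left k n)).trans (hb.top r _ (le_max_right k n)).le

theorem add_succ_le (hb : IsGTPattern lo hi n b) (r d k : ℕ) :
    b (r + d + 1) (k + 1) ≤ b r k := by
  induction d generalizing r with
  | zero => exact hb.succ_le r k
  | succ d ih =>
    have h1 := ih (r + 1)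
    have h2 := hb.succ_le r k
    have h3 := hb.le_succ (r + 1) k
    rw [show r + (d + 1) + 1 = r + 1 + d + 1 by ring]
    omega

theorem succ_le_of_lt (hb : IsGTPattern lo hi n b) {r s : ℕ} (h : r < s) (k : ℕ) :
    b s (k + 1) ≤ b r k := by
  obtain ⟨d, rfl⟩ := Nat.exists_eq_add_of_lt h
  exact hb.add_succ_le r d k

end IsGTPattern

/-- Entry `k` of row `r` is the first column of the row with a letter that is at least `k`. -/
noncomputable def rowBoundary {D : Finset (ℕ × ℕ)} (lo hi : ℕ → ℕ) (T : D → ℕ) (r k : ℕ) : ℕ :=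
  open Classical in
  lo r + ((Finset.Ico (lo r) (hi r)).filter
    fun c => ∃ h : (r, c) ∈ D, T ⟨(r, c), h⟩ < k).card

section Fillings

variable {D : Finset (ℕ × ℕ)} {lo hi : ℕ → ℕ} {R n : ℕ}

theorem lt_rowBoundary_iff (hD : IsSkewShape D lo hi R) {T : D → ℕ} (hT : IsSemistandard T)
    {r c : ℕ} (h : (r, c) ∈ D) (k : ℕ) :
    c < rowBoundary lo hi T r k ↔ T ⟨(r, c), h⟩ < k := by
  classical
  have hc := (hD.mem_iff r c).1 h
  unfold rowBoundary
  constructor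
  · intro hlt
    by_contra hk
    have hsub : ((Finset.Ico (lo r) (hi r)).filter
        fun c => ∃ h : (r, c) ∈ D, T ⟨(r, c), h⟩ < k) ⊆ Finset.Ico (lo r) c := by
      intro d hd
      simp only [Finset.mem_filter, Finset.mem_Ico] at hd ⊢
      obtain ⟨hd1, hd2, hd3⟩ := hd
      refine ⟨hd1.1, ?_⟩
      by_contra hcd
      rcases (not_lt.1 hcd).eq_or_lt with rfl | hcd
      · exact hk hd3
      · have := hT.1 ⟨(r, c), h⟩ ⟨(r, d), hd2⟩ rfl hcd
        omega
    have := Finset.card_le_card hsub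
    rw [Nat.card_Ico] at this
    omega
  · intro hk
    have hsub : Finset.Ico (lo r) (c + 1) ⊆ ((Finset.Ico (lo r) (hi r)).filter
        fun c => ∃ h : (r, c) ∈ D, T ⟨(r, c), h⟩ < k) := by
      intro d hd
      simp only [Finset.mem_filter, Finset.mem_Ico] at hd ⊢
      have hd2 : (r, d) ∈ D := (hD.mem_iff r d).2 ⟨hd.1, by omega⟩
      refine ⟨⟨hd.1, by omega⟩, hd2, ?_⟩
      rcases (Nat.lt_succ_iff.1 hd.2).eq_or_lt with rfl | hcd
      · exact hk
      · have := hT.1 ⟨(r, d), hd2⟩ ⟨(r, c), h⟩ rfl hcd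
        omega
    have := Finset.card_le_card hsub
    rw [Nat.card_Ico] at this
    omega

theorem rowBoundary_le (hD : IsSkewShape D lo hi R) (T : D → ℕ) (r k : ℕ) :
    rowBoundary lo hi T r k ≤ hi r := by
  classical
  unfold rowBoundary
  have := Finset.card_filter_le (Finset.Ico (lo r) (hi r))
    (fun c => ∃ h : (r, c) ∈ D, T ⟨(r, c), h⟩ < k)
  rw [Nat.card_Ico] at this
  have := hD.lo_le_hi r
  omega

theorem le_rowBoundary (T : D → ℕ) (r k : ℕ) : lo r ≤ rowBoundary lo hi T r k :=
  Nat.le_add_right _ _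

/-- Two boundaries in the same row interval agree if they cut it in the same way. -/
theorem eq_of_forall_mem_Ico_lt_iff {l h x y : ℕ} (hx : l ≤ x) (hx' : x ≤ h) (hy : l ≤ y) (hy' : y ≤ h)
    (H : ∀ c, l ≤ c → c < h → (c < x ↔ c < y)) : x = y := by
  rcases lt_trichotomy x y with hxy | hxy | hxy
  · have := H x hx (by omega)
    omega
  · exact hxy
  · have := H y hy (by omega)
    omega

theorem isGTPattern_rowBoundary (hD : IsSkewShape D lo hi R) {T : D → ℕ}
    (hT : IsSemistandard T) (hn : ∀ x, T x < n) :
    IsGTPattern lo hi n (rowBoundary lo hi T) where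
  zero r := by
    refine eq_of_forall_mem_Ico_lt_iff (le_rowBoundary T r 0) (rowBoundary_le hD T r 0) le_rfl
      (hD.lo_le_hi r) fun c h1 h2 => ?_
    rw [lt_rowBoundary_iff hD hT ((hD.mem_iff r c).2 ⟨h1, h2⟩)]
    omega
  top r k hk := by
    refine eq_of_forall_mem_Ico_lt_iff (le_rowBoundary T r k) (rowBoundary_le hD T r k) (hD.lo_le_hi r)
      le_rfl fun c h1 h2 => ?_
    rw [lt_rowBoundary_iff hD hT ((hD.mem_iff r c).2 ⟨h1, h2⟩)]
    exact ⟨fun _ => h2, fun _ => (hn _).trans_le hk⟩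
  le_succ r k := by
    by_contra hlt
    have h1 := le_rowBoundary (lo := lo) (hi := hi) T r (k + 1)
    have h2 := rowBoundary_le hD T r k
    have hm := (hD.mem_iff r (rowBoundary lo hi T r (k + 1))).2 ⟨h1, by omega⟩
    have h3 := (lt_rowBoundary_iff hD hT hm k).1 (not_le.1 hlt)
    have h4 := (lt_rowBoundary_iff hD hT hm (k + 1)).2 (by omega)
    omega
  succ_le r k := by
    by_contra hlt
    have h1 := le_rowBoundary (lo := lo) (hi := hi) T r k
    have h2 := rowBoundary_le hD T (r + 1) (k + 1)
    have h3 := hD.hi_anti (Nat.le_succ r)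
    have h4 := hD.lo_anti (Nat.le_succ r)
    simp only [Nat.succ_eq_add_one] at h3 h4
    have hm := (hD.mem_iff r (rowBoundary lo hi T r k)).2 ⟨h1, by omega⟩
    have hm' := (hD.mem_iff (r + 1) (rowBoundary lo hi T r k)).2 ⟨by omega, by omega⟩
    have h5 := (lt_rowBoundary_iff hD hT hm' (k + 1)).1 (not_le.1 hlt)
    have h6 := hT.2 ⟨_, hm⟩ ⟨_, hm'⟩ rfl (Nat.lt_succ_self r)
    have h7 := (lt_rowBoundary_iff hD hT hm k).2 (by omega)
    omega

theorem content_apply (T : D → ℕ) (k : ℕ) :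
    content T k = (Finset.univ.filter fun x => T x = k).card := by
  classical
  rw [content, Finsupp.finsetSum_apply, Finset.card_filter]
  simp only [Finsupp.single_apply]

/-- The letters of a filling with boundaries `b` are counted by `b`. -/
theorem letterCount_eq_content (hD : IsSkewShape D lo hi R) {T : D → ℕ} {b : ℕ → ℕ → ℕ}
    (hb : IsGTPattern lo hi n b)
    (hbT : ∀ (r c : ℕ) (h : (r, c) ∈ D) (k : ℕ), c < b r k ↔ T ⟨(r, c), h⟩ < k) (k : ℕ) :
    letterCount R b k = content T k := by
  classical
  have hmem : ∀ r c, c < b r (k + 1) → b r k ≤ c → (r, c) ∈ D := fun r c h1 h2 =>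
    (hD.mem_iff r c).2 ⟨(hb.lo_le r k).trans h2, h1.trans_le (hb.le_hi r _)⟩
  have hcard : (Finset.univ.filter fun x => T x = k).card =
      ((Finset.range R).sigma fun r => Finset.Ico (b r k) (b r (k + 1))).card := by
    refine Finset.card_bij' (fun x _ => ⟨x.1.1, x.1.2⟩)
      (fun y hy => ⟨(y.1, y.2), ?_⟩) ?_ ?_ ?_ ?_
    · simp only [Finset.mem_sigma, Finset.mem_Ico] at hy
      exact hmem _ _ hy.2.2 hy.2.1
    · rintro ⟨⟨r, c⟩, h⟩ hx
      simp only [Finset.mem_filter, Finset.mem_univ, true_and] at hx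
      simp only [Finset.mem_sigma, Finset.mem_range, Finset.mem_Ico]
      have h1 := hbT r c h k
      have h2 := hbT r c h (k + 1)
      have h3 := (hD.mem_iff r c).1 h
      refine ⟨?_, by omega, by omega⟩
      by_contra hR
      have := hD.hi_eq_zero r (not_lt.1 hR)
      omega
    · rintro ⟨r, c⟩ hy
      simp only [Finset.mem_sigma, Finset.mem_range, Finset.mem_Ico] at hy
      have h1 := hbT r c (hmem _ _ hy.2.2 hy.2.1) k
      have h2 := hbT r c (hmem _ _ hy.2.2 hy.2.1) (k + 1)
      simp only [Finset.mem_filter, Finset.mem_univ, true_and]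
      omega
    · intros; rfl
    · intros; rfl
  rw [content_apply, hcard, Finset.card_sigma, letterCount]
  push_cast
  refine Finset.sum_congr rfl fun r _ => ?_
  rw [Nat.card_Ico, Nat.cast_sub (hb.le_succ r k)]

/-- Every pattern comes from a semistandard filling. -/
theorem exists_filling_of_pattern (hD : IsSkewShape D lo hi R) {b : ℕ → ℕ → ℕ}
    (hb : IsGTPattern lo hi n b) : ∃ T : D → ℕ, IsSemistandard T ∧
      ∀ (r c : ℕ) (h : (r, c) ∈ D) (k : ℕ), c < b r k ↔ T ⟨(r, c), h⟩ < k := by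
  classical
  -- The letter of a box is the least `k` for which the box lies left of the boundary of level `k +
  -- 1`.
  have hex : ∀ x : D, ∃ k, x.1.2 < b x.1.1 (k + 1) := fun x =>
    ⟨n, by rw [hb.top _ _ (Nat.le_succ n)]; exact ((hD.mem_iff x.1.1 x.1.2).1 x.2).2⟩
  have key : ∀ (r c : ℕ) (h : (r, c) ∈ D) (k : ℕ),
      c < b r k ↔ Nat.find (hex ⟨(r, c), h⟩) < k := by
    intro r c h k
    constructor
    · intro hc
      rcases k with _ | k
      · rw [hb.zero] at hc
        have := (hD.mem_iff r c).1 h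
        omega
      · exact Nat.lt_succ_of_le (Nat.find_min' (hex ⟨(r, c), h⟩) hc)
    · intro hk
      exact (Nat.find_spec (hex ⟨(r, c), h⟩)).trans_le (hb.mono r hk)
  refine ⟨fun x => Nat.find (hex x), ⟨?_, ?_⟩, key⟩
  · rintro ⟨⟨r, c⟩, h⟩ ⟨⟨r', d⟩, h'⟩ (rfl : r = r') (hcd : c < d)
    have h1 := (key r d h' _).2 (Nat.lt_succ_self _)
    exact Nat.lt_succ_iff.1 ((key r c h _).1 (hcd.trans h1))
  · rintro ⟨⟨r, c⟩, h⟩ ⟨⟨r', d⟩, h'⟩ (rfl : c = d) (hr : r < r')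
    have h1 := (key r' c h' _).2 (Nat.lt_succ_self _)
    exact (key r c h _).1 (h1.trans_le (hb.succ_le_of_lt hr _))

theorem card_fillings_eq_card_patterns (hD : IsSkewShape D lo hi R) (γ : ℕ →₀ ℕ)
    (hγ : ∀ k, n ≤ k → γ k = 0) :
    Nat.card {T : D → ℕ // IsSemistandard T ∧ content T = γ} =
      Nat.card {b // IsGTPattern lo hi n b ∧ ∀ k, letterCount R b k = γ k} := by
  have hn : ∀ T : D → ℕ, content T = γ → ∀ x, T x < n := by
    intro T hT x
    by_contra hx
    have h1 : content T (T x) = 0 := hT ▸ hγ _ (not_lt.1 hx)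
    rw [content_apply, Finset.card_eq_zero] at h1
    have : x ∈ Finset.univ.filter fun y => T y = T x := by simp
    rw [h1] at this
    simp at this
  refine Nat.card_eq_of_bijective (fun T => ⟨rowBoundary lo hi T.1, ?_, fun k => ?_⟩) ⟨?_, ?_⟩
  · exact isGTPattern_rowBoundary hD T.2.1 (hn T.1 T.2.2)
  · rw [letterCount_eq_content hD (isGTPattern_rowBoundary hD T.2.1 (hn T.1 T.2.2))
      (fun r c h k => lt_rowBoundary_iff hD T.2.1 h k), T.2.2]
  · rintro ⟨T, hT, hTγ⟩ ⟨U, hU, hUγ⟩ h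
    simp only [Subtype.mk.injEq] at h ⊢
    funext ⟨⟨r, c⟩, hx⟩
    have h1 := fun k => lt_rowBoundary_iff hD hT hx k
    have h2 := fun k => lt_rowBoundary_iff hD hU hx k
    rw [h] at h1
    refine le_antisymm ?_ ?_
    · exact Nat.lt_succ_iff.1 ((h1 _).1 ((h2 _).2 (Nat.lt_succ_self _)))
    · exact Nat.lt_succ_iff.1 ((h2 _).1 ((h1 _).2 (Nat.lt_succ_self _)))
  · rintro ⟨b, hb, hbγ⟩
    obtain ⟨T, hT, hbT⟩ := exists_filling_of_pattern hD hb
    refine ⟨⟨T, hT, ?_⟩, ?_⟩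
    · ext k
      have := letterCount_eq_content hD hb hbT k
      rw [hbγ] at this
      exact_mod_cast this.symm
    · simp only [Subtype.mk.injEq]
      funext r k
      refine eq_of_forall_mem_Ico_lt_iff (le_rowBoundary T r k) (rowBoundary_le hD T r k)
        (hb.lo_le r k) (hb.le_hi r k) fun c h1 h2 => ?_
      have hm := (hD.mem_iff r c).2 ⟨h1, h2⟩
      rw [lt_rowBoundary_iff hD hT hm, hbT r c hm]

theorem finite_patterns (hD : IsSkewShape D lo hi R) (n : ℕ) :
    {b | IsGTPattern lo hi n b}.Finite := by
  -- A pattern is determined by its rows `< R` and levels `< n`, with values at most `hi 0`; the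
  -- `min` only makes the map total.
  refine Set.Finite.of_finite_image (f := fun b (r : Fin R) (k : Fin n) =>
    (⟨min (b r k) (hi 0), by omega⟩ : Fin (hi 0 + 1))) (Set.toFinite _) ?_
  intro b hb b' hb' h
  funext r k
  rcases lt_or_ge r R with hr | hr
  · rcases lt_or_ge k n with hk | hk
    · have h1 := congrFun (congrFun h ⟨r, hr⟩) ⟨k, hk⟩
      simp only [Fin.mk.injEq] at h1
      have h2 := hb.le_hi r k
      have h3 := hb'.le_hi r k
      have h4 := hD.hi_anti (Nat.zero_le r)
      omega
    · rw [hb.top r k hk, hb'.top r k hk]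
  · have h2 := hb.le_hi r k
    have h3 := hb'.le_hi r k
    have h4 := hD.hi_eq_zero r hr
    omega

end Fillings

/-! ### Good fillings and the Bender-Knuth toggle left of a column. -/

/-- Sum over the rows of the boundaries of level `m`, cut off from below at column `j`. -/
def rightSum (R : ℕ) (b : ℕ → ℕ → ℕ) (j m : ℕ) : ℤ :=
  ∑ r ∈ Finset.range R, max (b r m : ℤ) j

/-- The columns `≥ j` contain more letters `k + 1` than letters `k`. -/
def IsBadAt (n R : ℕ) (b : ℕ → ℕ → ℕ) (j k : ℕ) : Prop :=
  k + 1 < n ∧ 2 * rightSum R b j (k + 1) < rightSum R b j (k + 2) + rightSum R b j k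

/-- For every `j`, the content of the columns `≥ j` is a partition. -/
def IsGood (n R : ℕ) (b : ℕ → ℕ → ℕ) : Prop := ∀ j k, ¬ IsBadAt n R b j k

/-- `j` is the rightmost column for which the content of the columns `≥ j` is not a partition,
and `k` is the smallest letter witnessing this. -/
def IsFirstBad (n R : ℕ) (b : ℕ → ℕ → ℕ) (j k : ℕ) : Prop :=
  IsBadAt n R b j k ∧ (∀ j', j < j' → ∀ k', ¬ IsBadAt n R b j' k') ∧
    ∀ k', k' < k → ¬ IsBadAt n R b j k'

/-- The Bender-Knuth involution, exchanging the letters `k` and `k + 1`, on the columns `< j`. -/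
def toggle (b : ℕ → ℕ → ℕ) (j k : ℕ) : ℕ → ℕ → ℕ := fun r m =>
  -- Reflection of `b r (k + 1)` in the interval of values permitted by the neighbouring boundaries
  -- and by `j`. Row `0` has no row above it, and `j` then serves as a bound that changes nothing.
  if m = k + 1 ∧ b r m ≤ j then
    max (b r k) (b (r + 1) (k + 2)) + min (min (b r (k + 2)) j) (if r = 0 then j else b (r - 1) k)
      - b r m
  else b r m

theorem toggle_of_ne (b : ℕ → ℕ → ℕ) {j k m : ℕ} (h : m ≠ k + 1) (r : ℕ) :
    toggle b j k r m = b r m := by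
  simp [toggle, h]

theorem toggle_of_lt (b : ℕ → ℕ → ℕ) {j k r : ℕ} (h : j < b r (k + 1)) :
    toggle b j k r (k + 1) = b r (k + 1) := by
  simp [toggle, not_le.2 h]

section Toggle

variable {D : Finset (ℕ × ℕ)} {lo hi : ℕ → ℕ} {R n j k : ℕ} {b : ℕ → ℕ → ℕ}

/-- The defining equation of the toggle, without subtraction, and the bounds on its value. -/
theorem toggle_of_le (hb : IsGTPattern lo hi n b) {r : ℕ} (h : b r (k + 1) ≤ j) :
    toggle b j k r (k + 1) + b r (k + 1) = max (b r k) (b (r + 1) (k + 2)) +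
      min (min (b r (k + 2)) j) (if r = 0 then j else b (r - 1) k) ∧
    b r k ≤ toggle b j k r (k + 1) ∧ b (r + 1) (k + 2) ≤ toggle b j k r (k + 1) ∧
    toggle b j k r (k + 1) ≤ b r (k + 2) ∧ toggle b j k r (k + 1) ≤ j ∧
    toggle b j k r (k + 1) ≤ (if r = 0 then j else b (r - 1) k) := by
  have h1 := hb.le_succ r k
  have h2 := hb.le_succ r (k + 1)
  have h3 := hb.succ_le r (k + 1)
  have h4 : b r (k + 1) ≤ if r = 0 then j else b (r - 1) k := by
    rcases r with _ | r
    · simpa using h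
    · simpa using hb.succ_le r k
  have h5 : toggle b j k r (k + 1) = max (b r k) (b (r + 1) (k + 2)) +
      min (min (b r (k + 2)) j) (if r = 0 then j else b (r - 1) k) - b r (k + 1) := by
    simp only [toggle, h, and_self, if_true]
  generalize (if r = 0 then j else b (r - 1) k) = u at *
  simp only [Nat.add_assoc, Nat.reduceAdd] at *
  omega

/-- The endpoints of the reflection interval encode the pattern inequalities involving level `k +
1`, so the reflected value satisfies them again. -/
theorem IsGTPattern.toggle (hb : IsGTPattern lo hi n b) (hk : k + 1 < n) :
    IsGTPattern lo hi n (toggle b j k) where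
  zero r := by rw [toggle_of_ne b (by omega), hb.zero]
  top r m hm := by rw [toggle_of_ne b (by omega), hb.top r m hm]
  le_succ r m := by
    have h0 := hb.le_succ r m
    by_cases hj : b r (k + 1) ≤ j
    · have := toggle_of_le hb hj
      by_cases h1 : m = k + 1
      · subst h1
        rw [toggle_of_ne b (m := k + 1 + 1) (by omega)]
        exact this.2.2.2.1
      · by_cases h2 : m = k
        · subst h2
          rw [toggle_of_ne b (m := m) (by omega)]
          exact this.2.1
        · rwa [toggle_of_ne b h1, toggle_of_ne b (by omega)]
    · have h3 : ∀ m, _root_.toggle b j k r m = b r m := fun m => by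
        by_cases h1 : m = k + 1
        · subst h1
          exact toggle_of_lt b (not_le.1 hj)
        · exact toggle_of_ne b h1 r
      rwa [h3, h3]
  succ_le r m := by
    have h0 := hb.succ_le r m
    by_cases h1 : m = k + 1
    · subst h1
      rw [toggle_of_ne b (m := k + 1 + 1) (by omega)]
      by_cases hj : b r (k + 1) ≤ j
      · exact (toggle_of_le hb hj).2.2.1
      · rwa [toggle_of_lt b (not_le.1 hj)]
    · rw [toggle_of_ne b h1]
      by_cases h2 : m = k
      · subst h2
        by_cases hj : b (r + 1) (m + 1) ≤ j
        · simpa using (toggle_of_le hb hj).2.2.2.2.2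
        · rwa [toggle_of_lt b (not_le.1 hj)]
      · rwa [toggle_of_ne b (by omega)]

/-- The reflection interval depends only on levels `k` and `k + 2`, which the toggle fixes, and the
condition `b r (k + 1) ≤ j` is preserved. -/
theorem toggle_toggle (hb : IsGTPattern lo hi n b) (hk : k + 1 < n) :
    toggle (toggle b j k) j k = b := by
  have hb' := hb.toggle (j := j) hk
  funext r m
  by_cases h1 : m = k + 1
  · subst h1
    by_cases hj : b r (k + 1) ≤ j
    · have h2 := toggle_of_le hb hj
      have h3 := toggle_of_le hb' h2.2.2.2.2.1
      have h4 : ∀ s, toggle b j k s k = b s k := toggle_of_ne b (by omega)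
      have h5 : ∀ s, toggle b j k s (k + 2) = b s (k + 2) := toggle_of_ne b (by omega)
      simp only [h4, h5] at h3
      omega
    · rw [toggle_of_lt _ (by rw [toggle_of_lt b (not_le.1 hj)]; exact not_le.1 hj),
        toggle_of_lt b (not_le.1 hj)]
  · rw [toggle_of_ne _ h1, toggle_of_ne _ h1]

/-- Boundaries that move stay `≤ j`, so they are invisible after truncation at `j' ≥ j`.
Consequently the first bad place survives the toggle. -/
theorem rightSum_toggle (hb : IsGTPattern lo hi n b) {j' : ℕ} (hj' : j ≤ j') (m : ℕ) :
    rightSum R (toggle b j k) j' m = rightSum R b j' m := by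
  refine Finset.sum_congr rfl fun r _ => ?_
  by_cases h1 : m = k + 1
  · subst h1
    by_cases hj : b r (k + 1) ≤ j
    · have h2 := (toggle_of_le hb hj).2.2.2.2.1
      omega
    · rw [toggle_of_lt b (not_le.1 hj)]
  · rw [toggle_of_ne _ h1]

theorem isBadAt_toggle_iff (hb : IsGTPattern lo hi n b) {j' : ℕ} (hj' : j ≤ j') (k' : ℕ) :
    IsBadAt n R (toggle b j k) j' k' ↔ IsBadAt n R b j' k' := by
  simp only [IsBadAt, rightSum_toggle hb hj']

theorem IsFirstBad.toggle (hb : IsGTPattern lo hi n b) (h : IsFirstBad n R b j k) :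
    IsFirstBad n R (toggle b j k) j k := by
  refine ⟨(isBadAt_toggle_iff hb le_rfl k).2 h.1, fun j' hj' k' => ?_, fun k' hk' => ?_⟩
  · rw [isBadAt_toggle_iff hb hj'.le]
    exact h.2.1 j' hj' k'
  · rw [isBadAt_toggle_iff hb le_rfl]
    exact h.2.2 k' hk'

theorem IsFirstBad.unique {j' k' : ℕ} (h : IsFirstBad n R b j k) (h' : IsFirstBad n R b j' k') :
    j = j' ∧ k = k' := by
  obtain rfl : j = j' := by
    rcases lt_trichotomy j j' with hj | hj | hj
    · exact absurd h'.1 (h.2.1 _ hj _)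
    · exact hj
    · exact absurd h.1 (h'.2.1 _ hj _)
  refine ⟨rfl, ?_⟩
  rcases lt_trichotomy k k' with hk | hk | hk
  · exact absurd h.1 (h'.2.2 _ hk)
  · exact hk
  · exact absurd h'.1 (h.2.2 _ hk)

theorem not_isBadAt_of_le (hD : IsSkewShape D lo hi R) (hb : IsGTPattern lo hi n b)
    (hj : hi 0 ≤ j) : ¬ IsBadAt n R b j k := by
  have h : ∀ m, rightSum R b j m = ∑ r ∈ Finset.range R, (j : ℤ) := fun m =>
    Finset.sum_congr rfl fun r _ => by
      have h1 := hb.le_hi r m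
      have h2 := hD.hi_anti (Nat.zero_le r)
      omega
  rintro ⟨-, h1⟩
  rw [h, h, h] at h1
  omega

theorem exists_isFirstBad (hD : IsSkewShape D lo hi R) (hb : IsGTPattern lo hi n b)
    (h : ¬ IsGood n R b) : ∃ j k, IsFirstBad n R b j k := by
  classical
  simp only [IsGood, not_forall, not_not] at h
  obtain ⟨j₀, h⟩ := h
  have hle : ∀ j, (∃ k, IsBadAt n R b j k) → j ≤ hi 0 := fun j ⟨k, hk⟩ => by
    by_contra hj
    exact not_isBadAt_of_le hD hb (not_le.1 hj).le hk
  have hspec := Nat.findGreatest_spec (P := fun j => ∃ k, IsBadAt n R b j k) (hle j₀ h) h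
  refine ⟨_, Nat.find hspec, Nat.find_spec hspec, fun j' hj' k' hk' => ?_,
    fun k' hk' => Nat.find_min hspec hk'⟩
  exact Nat.findGreatest_is_greatest hj' (hle j' ⟨k', hk'⟩) ⟨k', hk'⟩

/-- A column contains each letter at most once. -/
theorem card_column_letter_le_one (hb : IsGTPattern lo hi n b) (j m : ℕ) :
    ((Finset.range R).filter fun r => b r m ≤ j ∧ j < b r (m + 1)).card ≤ 1 := by
  refine Finset.card_le_one.2 fun r hr s hs => ?_
  simp only [Finset.mem_filter] at hr hs
  rcases lt_trichotomy r s with h | h | h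
  · have := hb.succ_le_of_lt h m
    omega
  · exact h
  · have := hb.succ_le_of_lt h m
    omega

/-- Differences of `rightSum` in the level count the letters `m` in the columns `≥ j`; comparing `j`
with `j + 1` isolates column `j`. -/
theorem rightSum_sub_rightSum (hb : IsGTPattern lo hi n b) (j m : ℕ) :
    (rightSum R b j (m + 1) - rightSum R b j m) -
      (rightSum R b (j + 1) (m + 1) - rightSum R b (j + 1) m) =
    ((Finset.range R).filter fun r => b r m ≤ j ∧ j < b r (m + 1)).card := by
  rw [Finset.card_filter]
  push_cast
  simp only [rightSum, ← Finset.sum_sub_distrib]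
  refine Finset.sum_congr rfl fun r _ => ?_
  have := hb.le_succ r m
  push_cast
  split_ifs <;> omega

/-- Columns `≥ j + 1` are not bad and column `j` contributes at most one letter `k + 1`. Badness at
`j` therefore forces column `j` to contain `k + 1` but not `k`, with excess exactly one. -/
theorem IsFirstBad.excess (hb : IsGTPattern lo hi n b) (h : IsFirstBad n R b j k) :
    rightSum R b j (k + 2) + rightSum R b j k = 2 * rightSum R b j (k + 1) + 1 ∧
    ∀ r, r < R → j < b r (k + 1) → j < b r k := by
  have h1 := h.1.2
  have h2 := h.2.1 (j + 1) (Nat.lt_succ_self j) k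
  simp only [IsBadAt, h.1.1, true_and, not_lt] at h2
  have h3 := rightSum_sub_rightSum (R := R) hb j k
  have h4 := rightSum_sub_rightSum (R := R) hb j (k + 1)
  have h5 := card_column_letter_le_one (R := R) hb j (k + 1)
  simp only [Nat.add_assoc, Nat.reduceAdd] at *
  refine ⟨by omega, fun r hr hj => ?_⟩
  by_contra hk
  have h6 : 0 < ((Finset.range R).filter fun r => b r k ≤ j ∧ j < b r (k + 1)).card :=
    Finset.card_pos.2 ⟨r, by simp [hr, hj, not_lt.1 hk]⟩
  omega

/-- The toggle exchanges the numbers of letters `k` and `k + 1` in the columns `< j`, provided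
that column `j` does not contain `k`. -/
theorem sum_min_toggle (hD : IsSkewShape D lo hi R) (hb : IsGTPattern lo hi n b)
    (hcol : ∀ r, r < R → j < b r (k + 1) → j < b r k) :
    ∑ r ∈ Finset.range R, ((min (toggle b j k r (k + 1)) j : ℤ) + min (b r (k + 1) : ℤ) j) =
      ∑ r ∈ Finset.range R, ((min (b r k) j : ℤ) + min (b r (k + 2) : ℤ) j) := by
  set U : ℕ → ℕ := fun r => min (min (b r (k + 2)) j) (if r = 0 then j else b (r - 1) k) with hU
  have hterm : ∀ r ∈ Finset.range R,
      (min (toggle b j k r (k + 1)) j : ℤ) + min (b r (k + 1) : ℤ) j =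
        max (min (b r k : ℤ) j) (min (b (r + 1) (k + 2) : ℤ) j) + U r := by
    intro r hr
    have h1 := hb.le_succ r k
    have h2 := hb.le_succ r (k + 1)
    have h3 := hb.succ_le r (k + 1)
    simp only [Nat.add_assoc, Nat.reduceAdd] at h1 h2 h3
    by_cases hj : b r (k + 1) ≤ j
    · have h4 := toggle_of_le hb hj
      have h5 : U r = min (min (b r (k + 2)) j) (if r = 0 then j else b (r - 1) k) := rfl
      omega
    -- A boundary beyond `j` is not moved; since column `j` has no letter `k`, `b r k` also exceeds
    -- `j`, and every truncated term equals `j`.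
    · have h4 := hcol r (Finset.mem_range.1 hr) (not_le.1 hj)
      have h5 : U r = j := by
        rcases r with _ | r
        · simp only [hU, if_true]
          omega
        · have := hb.succ_le r k
          simp only [hU, Nat.add_eq_zero_iff, one_ne_zero, and_false, if_false,
            Nat.add_sub_cancel]
          omega
      rw [toggle_of_lt b (not_le.1 hj), h5]
      omega
  rw [Finset.sum_congr rfl hterm]
  -- The lower endpoint for row `r` and the upper endpoint for row `r + 1` are the maximum and the
  -- minimum of the same two truncated boundaries, so their sum splits and the total telescopes.
  have hind : ∀ m, ∑ r ∈ Finset.range m,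
      (max (min (b r k : ℤ) j) (min (b (r + 1) (k + 2) : ℤ) j) + U r) + U m =
      ∑ r ∈ Finset.range m, ((min (b r k) j : ℤ) + min (b r (k + 2) : ℤ) j) +
        min (b m (k + 2) : ℤ) j := by
    intro m
    induction m with
    | zero => simp [hU]
    | succ m ih =>
      rw [Finset.sum_range_succ, Finset.sum_range_succ]
      have h1 : U (m + 1) = min (min (b (m + 1) (k + 2)) j) (b m k) := by simp [hU]
      omega
  have h1 := hind R
  have h2 : b R (k + 2) = 0 := by
    have := hb.le_hi R (k + 2)
    rw [hD.hi_eq_zero R le_rfl] at this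
    omega
  have h3 : U R = 0 := by simp [hU, h2]
  rw [h2, h3] at h1
  simpa using h1

theorem letterCount_eq_rightSum (b : ℕ → ℕ → ℕ) (m : ℕ) :
    letterCount R b m = rightSum R b 0 (m + 1) - rightSum R b 0 m := by
  simp only [letterCount, rightSum, ← Finset.sum_sub_distrib]
  refine Finset.sum_congr rfl fun r _ => ?_
  omega

theorem rightSum_zero_eq (b : ℕ → ℕ → ℕ) (j m : ℕ) :
    rightSum R b 0 m = ∑ r ∈ Finset.range R, min (b r m : ℤ) j + rightSum R b j m - R * j := by
  have h : (R * j : ℤ) = ∑ r ∈ Finset.range R, (j : ℤ) := by simp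
  rw [h, rightSum, rightSum, ← Finset.sum_add_distrib, ← Finset.sum_sub_distrib]
  refine Finset.sum_congr rfl fun r _ => ?_
  omega

/-- Toggling at the first bad place: with `k` subtracted from the number of letters `k`, the values
for `k` and `k + 1` are exchanged. -/
theorem letterCount_toggle (hD : IsSkewShape D lo hi R) (hb : IsGTPattern lo hi n b)
    (h : IsFirstBad n R b j k) :
    letterCount R (toggle b j k) k = letterCount R b (k + 1) - 1 ∧
    letterCount R (toggle b j k) (k + 1) = letterCount R b k + 1 ∧
    ∀ m, m ≠ k → m ≠ k + 1 → letterCount R (toggle b j k) m = letterCount R b m := by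
  have hne : ∀ m, m ≠ k + 1 → rightSum R (toggle b j k) 0 m = rightSum R b 0 m := fun m hm =>
    Finset.sum_congr rfl fun r _ => by rw [toggle_of_ne b hm]
  obtain ⟨hex, hcol⟩ := h.excess hb
  have hmin := sum_min_toggle hD hb hcol
  rw [Finset.sum_add_distrib, Finset.sum_add_distrib] at hmin
  have h0 := rightSum_zero_eq (R := R) (toggle b j k) j (k + 1)
  rw [rightSum_toggle hb le_rfl] at h0
  have h1 := rightSum_zero_eq (R := R) b j k
  have h2 := rightSum_zero_eq (R := R) b j (k + 1)
  have h3 := rightSum_zero_eq (R := R) b j (k + 2)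
  have h4 := hne k (by omega)
  have h5 := hne (k + 2) (by omega)
  simp only [letterCount_eq_rightSum, Nat.add_assoc, Nat.reduceAdd] at *
  refine ⟨by linarith, by linarith, fun m hm hm' => ?_⟩
  rw [hne m hm', hne (m + 1) (by omega)]

end Toggle

/-! ### The sign-reversing involution. -/

/-- The shifted content of the filling with pattern `b` is `w` applied to the shifted partition
`ν`. -/
def IsShiftedContent (n R : ℕ) (ν : ℕ → ℕ) (b : ℕ → ℕ → ℕ) (w : Equiv.Perm (Fin n)) : Prop :=
  ∀ k : Fin n, letterCount R b k - k = (ν (w k) : ℤ) - (w k : ℕ)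

section Cancellation

variable {D : Finset (ℕ × ℕ)} {lo hi : ℕ → ℕ} {R n : ℕ} {b : ℕ → ℕ → ℕ} {ν : ℕ → ℕ}

theorem IsShiftedContent.toggle (hD : IsSkewShape D lo hi R) (hb : IsGTPattern lo hi n b)
    {j k : ℕ} (h : IsFirstBad n R b j k) {w : Equiv.Perm (Fin n)}
    (hw : IsShiftedContent n R ν b w) :
    IsShiftedContent n R ν (toggle b j k)
      (w * Equiv.swap ⟨k, (Nat.lt_succ_self k).trans h.1.1⟩ ⟨k + 1, h.1.1⟩) := by
  obtain ⟨h1, h2, h3⟩ := letterCount_toggle hD hb h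
  intro m
  rw [Equiv.Perm.mul_apply]
  by_cases hm : m = ⟨k, (Nat.lt_succ_self k).trans h.1.1⟩
  · subst hm
    rw [Equiv.swap_apply_left, ← hw, h1]
    push_cast
    ring
  · by_cases hm' : m = ⟨k + 1, h.1.1⟩
    · subst hm'
      rw [Equiv.swap_apply_right, ← hw, h2]
      push_cast
      ring
    · rw [Equiv.swap_apply_of_ne_of_ne hm hm', ← hw,
        h3 m (fun h => hm (Fin.ext h)) (fun h => hm' (Fin.ext h))]

theorem IsGood.letterCount_succ_le (h : IsGood n R b) {k : ℕ} (hk : k + 1 < n) :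
    letterCount R b (k + 1) ≤ letterCount R b k := by
  have := h 0 k
  simp only [IsBadAt, hk, true_and, not_lt] at this
  simp only [letterCount_eq_rightSum, Nat.add_assoc, Nat.reduceAdd]
  linarith

/-- Both shifted sequences are strictly decreasing, so `w` is strictly increasing, and the only
order automorphism of `Fin n` is the identity. -/
theorem IsGood.perm_eq_one (h : IsGood n R b) (hν : Antitone ν) {w : Equiv.Perm (Fin n)}
    (hw : IsShiftedContent n R ν b w) : w = 1 := by
  have h1 : StrictAnti fun k : Fin n => letterCount R b k - (k : ℕ) := by
    rcases n with _ | n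
    · exact fun k => k.elim0
    · refine Fin.strictAnti_iff_succ_lt.2 fun k => ?_
      have := h.letterCount_succ_le (k := k) (by omega)
      simp only [Fin.val_succ, Fin.val_castSucc]
      push_cast
      linarith
  have h2 : StrictAnti fun k : Fin n => (ν k : ℤ) - (k : ℕ) := by
    intro x y hxy
    have h3 := hν (Fin.le_def.1 hxy.le)
    have h4 := Fin.lt_def.1 hxy
    simp only
    omega
  have h3 : StrictMono w := by
    intro x y hxy
    have := h1 hxy
    simp only [hw x, hw y] at this
    exact (StrictAnti.lt_iff_gt h2).1 this
  have h4 : h3.orderIsoOfSurjective w w.surjective = OrderIso.refl (Fin n) := Subsingleton.elim _ _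
  exact Equiv.ext fun x => DFunLike.congr_fun h4 x

/-- The sign-reversing involution cancels all fillings but the good ones with content `ν`. -/
theorem sum_sign_eq_card_good (hD : IsSkewShape D lo hi R) (hν : Antitone ν) :
    open Classical in
    ∑ x ∈ ((finite_patterns hD n).toFinset ×ˢ (Finset.univ : Finset (Equiv.Perm (Fin n)))).filter
        (fun x => IsShiftedContent n R ν x.1 x.2), ((Equiv.Perm.sign x.2 : ℤ) : ℚ) =
      Nat.card {b // IsGTPattern lo hi n b ∧ IsGood n R b ∧
        ∀ k < n, letterCount R b k = ν k} := by
  classical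
  rw [← Finset.sum_filter_add_sum_filter_not _ (fun x => IsGood n R x.1)]
  have hbad : ∀ x ∈ ((((finite_patterns hD n).toFinset ×ˢ
      (Finset.univ : Finset (Equiv.Perm (Fin n)))).filter
        (fun x => IsShiftedContent n R ν x.1 x.2)).filter fun x => ¬ IsGood n R x.1),
      IsGTPattern lo hi n x.1 ∧ IsShiftedContent n R ν x.1 x.2 ∧
      ∃ p : ℕ × ℕ, IsFirstBad n R x.1 p.1 p.2 := by
    intro x hx
    simp only [Finset.mem_filter, Finset.mem_product, Set.Finite.mem_toFinset, Set.mem_ofPred_eq,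
      Finset.mem_univ, and_true] at hx
    obtain ⟨j, k, h⟩ := exists_isFirstBad hD hx.1.1 hx.2
    exact ⟨hx.1.1, hx.1.2, (j, k), h⟩
  have hzero := Finset.sum_involution (f := fun x : (ℕ → ℕ → ℕ) × Equiv.Perm (Fin n) =>
      ((Equiv.Perm.sign x.2 : ℤ) : ℚ))
    (fun x hx =>
      (toggle x.1 (hbad x hx).2.2.choose.1 (hbad x hx).2.2.choose.2,
        x.2 * Equiv.swap
          ⟨(hbad x hx).2.2.choose.2,
            (Nat.lt_succ_self _).trans (hbad x hx).2.2.choose_spec.1.1⟩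
          ⟨(hbad x hx).2.2.choose.2 + 1, (hbad x hx).2.2.choose_spec.1.1⟩))
    (fun x hx => by
      rw [Equiv.Perm.sign_mul, Equiv.Perm.sign_swap (by simp [Fin.ext_iff])]
      simp)
    -- The transposition reverses the sign, so there is no fixed point.
    (fun x hx _ heq => by
      have h := congrArg (fun y => Equiv.Perm.sign y.2) heq
      simp only [Equiv.Perm.sign_mul] at h
      rw [Equiv.Perm.sign_swap (by simp [Fin.ext_iff])] at h
      rcases Int.units_eq_one_or (Equiv.Perm.sign x.2) with h' | h' <;> rw [h'] at h <;>
        revert h <;> decide)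
    (fun x hx => by
      have hfb := (hbad x hx).2.2.choose_spec
      have hb := (hbad x hx).1
      simp only [Finset.mem_filter, Finset.mem_product, Set.Finite.mem_toFinset, Set.mem_ofPred_eq,
        Finset.mem_univ, and_true]
      exact ⟨⟨hb.toggle hfb.1.1, (hbad x hx).2.1.toggle hD hb hfb⟩,
        fun hg => hg _ _ (hfb.toggle hb).1⟩)
    (fun x hx => by
      have hfb := (hbad x hx).2.2.choose_spec
      have hb := (hbad x hx).1
      generalize_proofs _ _ _ p2 p3 p4
      -- The first bad place is unique, so the one chosen after toggling is the original one.
      have hu := p2.choose_spec.unique (hfb.toggle hb)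
      refine Prod.ext ?_ ?_
      · simp only [hu]
        exact toggle_toggle hb hfb.1.1
      · simp only [hu]
        rw [mul_assoc, Equiv.swap_mul_self, mul_one])
  rw [hzero, add_zero]
  have hone : ∀ x ∈ ((((finite_patterns hD n).toFinset ×ˢ
      (Finset.univ : Finset (Equiv.Perm (Fin n)))).filter
        (fun x => IsShiftedContent n R ν x.1 x.2)).filter fun x => IsGood n R x.1),
      x.2 = 1 := by
    intro x hx
    simp only [Finset.mem_filter] at hx
    exact hx.2.perm_eq_one hν hx.1.2
  rw [Finset.sum_congr rfl fun x hx => by rw [hone x hx]]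
  simp only [Equiv.Perm.sign_one, Units.val_one, Int.cast_one, Finset.sum_const, nsmul_eq_mul,
    mul_one, Nat.cast_inj]
  rw [← Fintype.card_coe, ← Nat.card_eq_fintype_card]
  refine Nat.card_congr
    { toFun := fun x => ⟨x.1.1, ?_⟩
      invFun := fun b => ⟨(b.1, 1), ?_⟩
      left_inv := fun x => Subtype.ext (Prod.ext rfl (hone x.1 x.2).symm)
      right_inv := fun b => rfl }
  · have h1 := hone x.1 x.2
    have hx := x.2
    simp only [Finset.mem_filter, Finset.mem_product, Set.Finite.mem_toFinset, Set.mem_ofPred_eq,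
      Finset.mem_univ, and_true] at hx
    refine ⟨hx.1.1, hx.2, fun k hk => ?_⟩
    have h2 := hx.1.2 ⟨k, hk⟩
    rw [h1] at h2
    simpa using h2
  · simp only [Finset.mem_filter, Finset.mem_product, Set.Finite.mem_toFinset, Set.mem_ofPred_eq,
      Finset.mem_univ, and_true]
    exact ⟨⟨b.2.1, fun k => by simp [b.2.2.2 k k.2]⟩, b.2.2.1⟩

end Cancellation

/-! ### A functional dual to the Schur functions. -/

section Schur

variable {D : Finset (ℕ × ℕ)} {lo hi : ℕ → ℕ} {R n : ℕ} {b : ℕ → ℕ → ℕ} {ν : ℕ → ℕ}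

theorem IsGTPattern.letterCount_eq_zero (hb : IsGTPattern lo hi n b) {k : ℕ} (hk : n ≤ k) (r : ℕ) :
    letterCount r b k = 0 :=
  Finset.sum_eq_zero fun q _ => by rw [hb.top q k hk, hb.top q (k + 1) (by omega), sub_self]

/-- In a good filling, the rows up to row `r` contain at most as many letters `k + 1` as the rows
above row `r` contain letters `k`. -/
theorem IsGood.letterCount_succ_le_letterCount (hg : IsGood n R b) (hb : IsGTPattern lo hi n b)
    {r k : ℕ} (hr : r < R) : letterCount (r + 1) b (k + 1) ≤ letterCount r b k := by
  by_cases hk : k + 1 < n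
  -- Cut at the first column of row `r` with a letter `≥ k + 1`: all letters `k + 1` in rows `≤ r`
  -- lie weakly to its right, while the letters `k` there all lie in rows `< r`.
  · have hbad := hg (b r (k + 1)) k
    simp only [IsBadAt, hk, true_and, not_lt] at hbad
    have hsplit : ∀ f : ℕ → ℤ, ∑ q ∈ Finset.range R, f q =
        ∑ q ∈ Finset.range r, f q + f r + ∑ q ∈ Finset.Ico (r + 1) R, f q := fun f => by
      rw [← Finset.sum_range_succ, Finset.sum_range_add_sum_Ico _ hr]
    have h1 : letterCount (r + 1) b (k + 1) ≤
        rightSum R b (b r (k + 1)) (k + 2) - rightSum R b (b r (k + 1)) (k + 1) := by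
      rw [rightSum, rightSum, ← Finset.sum_sub_distrib, hsplit, ← Finset.sum_range_succ]
      refine le_add_of_le_of_nonneg (Finset.sum_le_sum fun q hq => ?_)
        (Finset.sum_nonneg fun q _ => ?_)
      · have h2 := hb.le_succ r (k + 1)
        rcases (Nat.lt_succ_iff.1 (Finset.mem_range.1 hq)).eq_or_lt with rfl | hq
        · simp only [Nat.add_assoc, Nat.reduceAdd] at *
          omega
        · have h3 := hb.succ_le_of_lt hq (k + 1)
          have h4 := hb.le_succ q (k + 1)
          simp only [Nat.add_assoc, Nat.reduceAdd] at *
          omega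
      · have := hb.le_succ q (k + 1)
        simp only [Nat.add_assoc, Nat.reduceAdd] at *
        omega
    have h2 : rightSum R b (b r (k + 1)) (k + 1) - rightSum R b (b r (k + 1)) k ≤
        letterCount r b k := by
      rw [rightSum, rightSum, ← Finset.sum_sub_distrib, hsplit, letterCount, add_assoc]
      refine add_le_of_le_of_nonpos (Finset.sum_le_sum fun q _ => ?_)
        (add_nonpos ?_ (Finset.sum_nonpos fun q hq => ?_))
      · have := hb.le_succ q k
        omega
      · have := hb.le_succ r k
        omega
      · have h3 := hb.succ_le_of_lt (Finset.mem_Ico.1 hq).1 k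
        have h4 := hb.le_succ r k
        have h5 := hb.le_succ q k
        omega
    linarith
  · rw [hb.letterCount_eq_zero (not_lt.1 hk)]
    exact Finset.sum_nonneg fun q _ => by
      have := hb.le_succ q k
      omega

/-- The linear functional `∑_w sgn(w) [x^{w(ν + δ) - δ}]` in `n` variables. -/
noncomputable def alternatingCoeff (n : ℕ) (ν : ℕ → ℕ) : MvPowerSeries ℕ ℚ →ₗ[ℚ] ℚ :=
  open Classical in
  ∑ w : Equiv.Perm (Fin n), ((Equiv.Perm.sign w : ℤ) : ℚ) •
    -- The conditions determine `γ`; if the required exponent has a negative entry, no `γ` exists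
    -- and the term is `0`.
    if h : ∃ γ : ℕ →₀ ℕ, (∀ k, n ≤ k → γ k = 0) ∧
        ∀ k : Fin n, (γ k : ℤ) - (k : ℕ) = (ν (w k) : ℤ) - (w k : ℕ)
    then MvPowerSeries.coeff h.choose else 0

/-- Each coefficient counts the patterns with the prescribed shifted content, so the value is the
signed sum over pairs of a pattern and a permutation, which the involution evaluates. -/
theorem alternatingCoeff_schurFunction (hD : IsSkewShape D lo hi R) (hν : Antitone ν) :
    alternatingCoeff n ν (schurFunction D) =
      Nat.card {b // IsGTPattern lo hi n b ∧ IsGood n R b ∧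
        ∀ k < n, letterCount R b k = ν k} := by
  classical
  have hcard : ∀ P : (ℕ → ℕ → ℕ) → Prop, (Nat.card {b // IsGTPattern lo hi n b ∧ P b} : ℚ) =
      ∑ b ∈ (finite_patterns hD n).toFinset, if P b then 1 else 0 := fun P => by
    rw [← Finset.sum_filter, Finset.sum_const, nsmul_eq_mul, mul_one, Nat.cast_inj,
      ← Fintype.card_coe, ← Nat.card_eq_fintype_card]
    exact Nat.card_congr (Equiv.subtypeEquivRight fun b => by simp)
  rw [← sum_sign_eq_card_good hD hν, Finset.sum_filter, Finset.sum_product_right,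
    alternatingCoeff, LinearMap.sum_apply]
  refine Finset.sum_congr rfl fun w _ => ?_
  have hrhs : ∑ b ∈ (finite_patterns hD n).toFinset,
      (if IsShiftedContent n R ν b w then ((Equiv.Perm.sign w : ℤ) : ℚ) else 0) =
      ((Equiv.Perm.sign w : ℤ) : ℚ) *
        Nat.card {b // IsGTPattern lo hi n b ∧ IsShiftedContent n R ν b w} := by
    rw [hcard, Finset.mul_sum]
    exact Finset.sum_congr rfl fun b _ => by rw [mul_ite, mul_one, mul_zero]
  rw [hrhs, LinearMap.smul_apply, smul_eq_mul]
  congr 1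
  split_ifs with h
  · obtain ⟨h1, h2⟩ := h.choose_spec
    have h3 := card_fillings_eq_card_patterns hD h.choose h1
    refine (congrArg (Nat.cast : ℕ → ℚ) h3).trans (congrArg Nat.cast ?_)
    refine Nat.card_congr (Equiv.subtypeEquivRight fun b => and_congr_right fun hb => ?_)
    constructor
    · intro H k
      rw [H, h2]
    · intro H k
      rcases lt_or_ge k n with hk | hk
      · have h4 := H ⟨k, hk⟩
        rw [← h2] at h4
        simpa using h4
      · rw [h1 k hk, hb.letterCount_eq_zero hk, Nat.cast_zero]
  · have : IsEmpty {b // IsGTPattern lo hi n b ∧ IsShiftedContent n R ν b w} := by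
      refine ⟨fun b => h ?_⟩
      obtain ⟨T, hT, hbT⟩ := exists_filling_of_pattern hD b.2.1
      have hc := letterCount_eq_content hD b.2.1 hbT
      refine ⟨content T, fun k hk => ?_, fun k => ?_⟩
      · have := hc k
        rw [b.2.1.letterCount_eq_zero hk] at this
        exact_mod_cast this.symm
      · rw [← hc]
        exact b.2.2 k
    simp

/-- The pattern of the filling of a straight shape whose row `r` consists of letters `r`. -/
def yamanouchiPattern (hi : ℕ → ℕ) (r k : ℕ) : ℕ := if r < k then hi r else 0

theorem letterCount_yamanouchiPattern (hi0 : ∀ r, R ≤ r → hi r = 0) (k : ℕ) :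
    letterCount R (yamanouchiPattern hi) k = hi k := by
  have h : ∀ r ∈ Finset.range R, ((yamanouchiPattern hi r (k + 1) : ℤ) - yamanouchiPattern hi r k)
      = if k = r then (hi k : ℤ) else 0 := fun r _ => by
    unfold yamanouchiPattern
    by_cases h : k = r
    · subst h; simp
    · simp only [h, if_false]
      split_ifs <;> omega
  rw [letterCount, Finset.sum_congr rfl h, Finset.sum_ite_eq]
  split_ifs with hk
  · rfl
  · rw [hi0 k (by simpa using hk), Nat.cast_zero]

theorem isGTPattern_yamanouchiPattern (hanti : Antitone hi) (hn : ∀ r, n ≤ r → hi r = 0) :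
    IsGTPattern (fun _ => 0) hi n (yamanouchiPattern hi) where
  zero r := by simp [yamanouchiPattern]
  top r k hk := by
    unfold yamanouchiPattern
    split_ifs with h
    · rfl
    · exact (hn r (by omega)).symm
  le_succ r k := by
    unfold yamanouchiPattern
    split_ifs <;> omega
  succ_le r k := by
    have : hi (r + 1) ≤ hi r := hanti (Nat.le_succ r)
    unfold yamanouchiPattern
    split_ifs <;> omega

/-- The columns `≥ j` contain `max (hi m) j - j` letters `m`, which is weakly decreasing in `m`. -/
theorem isGood_yamanouchiPattern (hanti : Antitone hi) (hi0 : ∀ r, R ≤ r → hi r = 0) :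
    IsGood n R (yamanouchiPattern hi) := by
  rintro j k ⟨-, hbad⟩
  have h : ∀ m, rightSum R (yamanouchiPattern hi) j (m + 1) -
      rightSum R (yamanouchiPattern hi) j m = max (hi m : ℤ) j - j := fun m => by
    have h : ∀ r ∈ Finset.range R, max (yamanouchiPattern hi r (m + 1) : ℤ) j -
        max (yamanouchiPattern hi r m : ℤ) j = if m = r then (max (hi m : ℤ) j - j) else 0 :=
      fun r _ => by
        unfold yamanouchiPattern
        by_cases h : m = r
        · subst h; simp
        · simp only [h, if_false]
          split_ifs <;> omega
    rw [rightSum, rightSum, ← Finset.sum_sub_distrib, Finset.sum_congr rfl h, Finset.sum_ite_eq]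
    split_ifs with hk
    · rfl
    · rw [hi0 m (by simpa using hk)]
      omega
  have h1 := h k
  have h2 := h (k + 1)
  have h3 : hi (k + 1) ≤ hi k := hanti (Nat.le_succ k)
  simp only [Nat.add_assoc, Nat.reduceAdd] at h2
  omega

/-- A straight shape has at most one good filling. -/
theorem IsGood.eq_yamanouchiPattern (hg : IsGood n R b) (hi0 : ∀ r, R ≤ r → hi r = 0)
    (hb : IsGTPattern (fun _ => 0) hi n b) : b = yamanouchiPattern hi := by
  -- Descending one row and one letter at a time: the first `r` rows contain no letter `k ≥ r`, so
  -- row `r` has no letter above `r`.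
  have hcount : ∀ r k, r ≤ R → r ≤ k → letterCount r b k ≤ 0 := by
    intro r
    induction r with
    | zero => simp [letterCount]
    | succ r ih =>
      intro k hr hk
      obtain ⟨k, rfl⟩ := Nat.exists_eq_add_of_le' (Nat.le_of_add_left_le hk)
      exact (hg.letterCount_succ_le_letterCount hb hr).trans (ih k (by omega) (by omega))
  have hstep : ∀ r k, r < k → b r (k + 1) ≤ b r k := by
    intro r k hk
    rcases lt_or_ge r R with hr | hr
    · have h1 := hcount (r + 1) k hr hk
      have h2 : 0 ≤ letterCount r b k := Finset.sum_nonneg fun q _ => by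
        have := hb.le_succ q k
        omega
      rw [letterCount, Finset.sum_range_succ] at h1
      rw [letterCount] at h2
      omega
    · have := hb.le_hi r (k + 1)
      rw [hi0 r hr] at this
      omega
  -- Conversely, strict increase down the columns excludes letters below `r` from row `r`.
  have hzero : ∀ k r, k ≤ r → b r k = 0 := by
    intro k
    induction k with
    | zero => exact fun r _ => hb.zero r
    | succ k ih =>
      intro r hr
      obtain ⟨r, rfl⟩ := Nat.exists_eq_add_of_le' (Nat.le_of_add_left_le hr)
      have h1 := hb.succ_le r k
      rw [ih r (by omega)] at h1
      omega
  have hconst : ∀ r k d, r < k → b r (k + d) ≤ b r k := by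
    intro r k d hk
    induction d with
    | zero => exact le_rfl
    | succ d ih => exact (hstep r (k + d) (by omega)).trans ih
  funext r k
  unfold yamanouchiPattern
  split_ifs with h
  · refine le_antisymm (hb.le_hi r k) ?_
    have h1 := hconst r k n h
    rwa [hb.top r (k + n) (by omega)] at h1
  · exact hzero k r (not_lt.1 h)

theorem YoungDiagram.rowLen_eq_zero (μ : YoungDiagram) {r : ℕ} (hr : μ.colLen 0 ≤ r) :
    μ.rowLen r = 0 := by
  by_contra h
  have h1 := YoungDiagram.mem_iff_lt_rowLen.2 (Nat.pos_of_ne_zero h)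
  have h2 := YoungDiagram.mem_iff_lt_colLen.1 h1
  omega

theorem YoungDiagram.antitone_rowLen (μ : YoungDiagram) : Antitone μ.rowLen :=
  fun _ _ h => μ.rowLen_anti _ _ h

theorem YoungDiagram.isSkewShape (μ : YoungDiagram) :
    IsSkewShape μ.cells (fun _ => 0) μ.rowLen (μ.colLen 0) where
  mem_iff r c := by simp [YoungDiagram.mem_iff_lt_rowLen]
  lo_anti := antitone_const
  hi_anti := μ.antitone_rowLen
  lo_le_hi _ := Nat.zero_le _
  hi_eq_zero _ hr := μ.rowLen_eq_zero hr

theorem alternatingCoeff_schurFunction_young {ν : YoungDiagram} (hn : ν.colLen 0 ≤ n)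
    (μ : YoungDiagram) [Decidable (μ = ν)] :
    alternatingCoeff n ν.rowLen (schurFunction μ.cells) = if μ = ν then 1 else 0 := by
  rw [alternatingCoeff_schurFunction μ.isSkewShape ν.antitone_rowLen]
  split_ifs with h
  · subst h
    have : Unique {b // IsGTPattern (fun _ => 0) μ.rowLen n b ∧ IsGood n (μ.colLen 0) b ∧
        ∀ k < n, letterCount (μ.colLen 0) b k = μ.rowLen k} :=
      { default := ⟨yamanouchiPattern μ.rowLen,
          isGTPattern_yamanouchiPattern μ.antitone_rowLen
            fun r hr => μ.rowLen_eq_zero (hn.trans hr),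
          isGood_yamanouchiPattern μ.antitone_rowLen fun r hr => μ.rowLen_eq_zero hr,
          fun k _ => letterCount_yamanouchiPattern (fun r hr => μ.rowLen_eq_zero hr) k⟩
        uniq := fun b => Subtype.ext
          (b.2.2.1.eq_yamanouchiPattern (fun r hr => μ.rowLen_eq_zero hr) b.2.1) }
    rw [Nat.card_unique, Nat.cast_one]
  · have : IsEmpty {b // IsGTPattern (fun _ => 0) μ.rowLen n b ∧ IsGood n (μ.colLen 0) b ∧
        ∀ k < n, letterCount (μ.colLen 0) b k = ν.rowLen k} := by
      refine ⟨fun ⟨b, hb, hg, hc⟩ => h ?_⟩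
      have hrow : ∀ k, μ.rowLen k = ν.rowLen k := by
        obtain rfl := hg.eq_yamanouchiPattern (fun r hr => μ.rowLen_eq_zero hr) hb
        intro k
        rcases lt_or_ge k n with hk | hk
        · have h1 := hc k hk
          rw [letterCount_yamanouchiPattern fun r hr => μ.rowLen_eq_zero hr] at h1
          exact_mod_cast h1
        -- Letters are `< n`, while row `k` would consist of letters `k ≥ n`, so this row of `μ` is
        -- empty.
        · have h1 := hb.top k k hk
          rw [ν.rowLen_eq_zero (hn.trans hk), ← h1]
          simp [yamanouchiPattern]
      ext ⟨r, c⟩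
      rw [YoungDiagram.mem_cells, YoungDiagram.mem_cells, YoungDiagram.mem_iff_lt_rowLen,
        YoungDiagram.mem_iff_lt_rowLen, hrow]
    simp

/-- A positive Littlewood-Richardson coefficient yields a good filling. -/
theorem exists_good_of_lrCoeff_pos (hD : IsSkewShape D lo hi R) {ν : YoungDiagram}
    (hn : ν.colLen 0 ≤ n) (h : 0 < lrCoeff D ν) :
    ∃ b, IsGTPattern lo hi n b ∧ IsGood n R b ∧ ∀ k < n, letterCount R b k = ν.rowLen k := by
  classical
  unfold lrCoeff schurCoeff at h
  split_ifs at h with hex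
  -- The functional recovers the coefficient from whichever expansion was chosen, so uniqueness of
  -- the expansion need not be shown separately.
  · have hc := congrArg (alternatingCoeff n ν.rowLen) hex.choose_spec
    rw [map_finsuppSum, alternatingCoeff_schurFunction hD ν.antitone_rowLen] at hc
    simp only [map_smul, alternatingCoeff_schurFunction_young hn, smul_eq_mul, mul_ite, mul_one,
      mul_zero] at hc
    rw [Finsupp.sum_ite_self_eq'] at hc
    rw [← hc, Nat.cast_pos, Nat.card_pos_iff] at h
    obtain ⟨⟨b, hb⟩⟩ := h.1
    exact ⟨b, hb⟩
  · exact absurd h (lt_irrefl 0)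

end Schur

/-! ### Counting letters in good fillings of ribbons. -/

section Ribbon

variable {lo hi : ℕ → ℕ} {R n : ℕ} {b : ℕ → ℕ → ℕ}

open Classical in
/-- The contribution of row `q` to the number of columns of the rows of a ribbon that satisfy
`kept`. -/
noncomputable def newColumns (lo hi : ℕ → ℕ) (kept : ℕ → Prop) (q : ℕ) : ℤ :=
  if kept q then ((hi q : ℤ) - lo q) - (if 0 < q ∧ kept (q - 1) then 1 else 0) else 0

open Classical in
/-- In a good filling of a ribbon, if `i` of the first `r` rows are deleted, then the number of
letters `i` in the first `r` rows is at most the number of columns of the remaining ones. -/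
theorem IsGood.letterCount_le_sum_newColumns (hg : IsGood n R b) (hb : IsGTPattern lo hi n b)
    (hrib : ∀ r, r + 1 < R → hi (r + 1) = lo r + 1) (kept : ℕ → Prop) (r : ℕ) (hr : r ≤ R) :
    letterCount r b ((Finset.range r).filter fun q => ¬ kept q).card ≤
      ∑ q ∈ Finset.range r, newColumns lo hi kept q ∧
    -- Strengthening needed for overlaps: when the last row is kept, the bound improves by the
    -- number of its letters smaller than the current one.
    (0 < r → kept (r - 1) → letterCount r b ((Finset.range r).filter fun q => ¬ kept q).card ≤
      ∑ q ∈ Finset.range r, newColumns lo hi kept q + lo (r - 1) -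
        b (r - 1) ((Finset.range r).filter fun q => ¬ kept q).card) := by
  induction r with
  | zero => simp [letterCount]
  | succ r ih =>
    obtain ⟨ih1, ih2⟩ := ih (by omega)
    rw [Finset.sum_range_succ, Finset.range_add_one, Finset.filter_insert]
    by_cases hk : kept r
    · simp only [hk, not_true_eq_false, if_false, Nat.add_sub_cancel, true_implies,
        Nat.succ_pos]
      set m := ((Finset.range r).filter fun q => ¬ kept q).card
      have h1 : letterCount (r + 1) b m = letterCount r b m + (b r (m + 1) - b r m) :=
        Finset.sum_range_succ _ _
      have h2 := hb.lo_le r m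
      have h3 := hb.le_hi r (m + 1)
      suffices h : letterCount (r + 1) b m ≤ ∑ q ∈ Finset.range r, newColumns lo hi kept q +
          newColumns lo hi kept r + lo r - b r m from ⟨by omega, h⟩
      rw [newColumns, if_pos hk]
      -- If the row above is kept, strictness in the shared column bounds `b r (m + 1)` by `b (r -
      -- 1) m`; the improvement recorded for row `r - 1` then pays for the missing column.
      by_cases hr' : 0 < r ∧ kept (r - 1)
      · rw [if_pos hr']
        have h4 := ih2 hr'.1 hr'.2
        obtain ⟨s, rfl⟩ : ∃ s, r = s + 1 := ⟨r - 1, by omega⟩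
        have h5 := hrib s (by omega)
        have h6 := hb.succ_le s m
        simp only [Nat.add_sub_cancel] at h4
        omega
      · rw [if_neg hr']
        omega
    · have hcard : (insert r ((Finset.range r).filter fun q => ¬ kept q)).card =
          ((Finset.range r).filter fun q => ¬ kept q).card + 1 :=
        Finset.card_insert_of_notMem (by simp)
      simp only [hk, not_false_eq_true, if_true, hcard, Nat.add_sub_cancel, false_implies,
        implies_true, and_true, newColumns, if_false, add_zero]
      -- A deleted row advances the letter by one and adds no column.
      exact (hg.letterCount_succ_le_letterCount hb hr).trans ih1

variable {l : ℕ} {β : Fin l → ℕ}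

/-- The first column of row `r` of the ribbon, for arbitrary natural numbers `r`. -/
def ribbonLo (β : Fin l → ℕ) (r : ℕ) : ℕ := if h : r < l then ribbonStart β ⟨r, h⟩ else 0

/-- The first column to the right of row `r` of the ribbon. -/
def ribbonHi (β : Fin l → ℕ) (r : ℕ) : ℕ :=
  if h : r < l then ribbonStart β ⟨r, h⟩ + β ⟨r, h⟩ else 0

theorem ribbonLo_val (r : Fin l) : ribbonLo β r = ribbonStart β r := by simp [ribbonLo]

theorem ribbonHi_val (r : Fin l) : ribbonHi β r = ribbonStart β r + β r := by simp [ribbonHi]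

theorem mem_ribbonRow {r : Fin l} {x : ℕ × ℕ} :
    x ∈ ribbonRow β r ↔ x.1 = r ∧ ribbonLo β r ≤ x.2 ∧ x.2 < ribbonHi β r := by
  obtain ⟨s, c⟩ := x
  simp only [ribbonRow, Finset.mem_image, Finset.mem_range, Prod.mk.injEq, ribbonLo_val,
    ribbonHi_val]
  constructor
  · rintro ⟨j, hj, h1, h2⟩
    omega
  · rintro ⟨h1, h2, h3⟩
    exact ⟨c - ribbonStart β r, by omega, h1.symm, by omega⟩

theorem ribbonHi_succ (hβ : ∀ r, 0 < β r) {r : ℕ} (hr : r + 1 < l) :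
    ribbonHi β (r + 1) = ribbonLo β r + 1 := by
  have h : Finset.Ioi (⟨r, by omega⟩ : Fin l) =
      insert (⟨r + 1, hr⟩ : Fin l) (Finset.Ioi ⟨r + 1, hr⟩) := by
    ext q
    simp only [Finset.mem_Ioi, Finset.mem_insert, Fin.lt_def, Fin.ext_iff]
    omega
  have h1 := hβ ⟨r + 1, hr⟩
  rw [ribbonHi, dif_pos hr, ribbonLo, dif_pos (by omega : r < l), ribbonStart, ribbonStart, h,
    Finset.sum_insert (by simp)]
  omega

theorem isSkewShape_connectedRibbon (hβ : ∀ r, 0 < β r) :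
    IsSkewShape (connectedRibbon β) (ribbonLo β) (ribbonHi β) l where
  mem_iff r c := by
    simp only [connectedRibbon, Finset.mem_biUnion, Finset.mem_univ, true_and, mem_ribbonRow]
    constructor
    · rintro ⟨q, rfl, h⟩
      exact h
    · intro h
      by_cases hr : r < l
      · exact ⟨⟨r, hr⟩, rfl, h⟩
      · simp [ribbonHi, hr] at h
  lo_anti := antitone_nat_of_succ_le fun r => by
    by_cases hr : r + 1 < l
    · have h1 := ribbonHi_succ hβ hr
      have h2 := hβ ⟨r + 1, hr⟩
      have h3 := ribbonLo_val (β := β) ⟨r + 1, hr⟩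
      have h4 := ribbonHi_val (β := β) ⟨r + 1, hr⟩
      simp only at h3 h4
      omega
    · simp [ribbonLo, hr]
  hi_anti := antitone_nat_of_succ_le fun r => by
    by_cases hr : r + 1 < l
    · have h1 := ribbonHi_succ hβ hr
      have h2 := hβ ⟨r, by omega⟩
      have h3 := ribbonLo_val (β := β) ⟨r, by omega⟩
      have h4 := ribbonHi_val (β := β) ⟨r, by omega⟩
      simp only at h3 h4
      omega
    · simp [ribbonHi, hr]
  lo_le_hi r := by
    unfold ribbonLo ribbonHi
    split_ifs <;> omega
  hi_eq_zero r hr := by simp [ribbonHi, not_lt.2 hr]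

open Classical in
/-- Columns of length two of a union of rows of a ribbon come from pairs of consecutive rows. -/
theorem numColumnsTwo_biUnion_ribbonRow_le (hβ : ∀ r, 2 ≤ β r) (s : Finset (Fin l)) :
    numColumnsTwo (s.biUnion (ribbonRow β)) ≤ ((Finset.range l).filter fun q =>
      (∃ h : q < l, (⟨q, h⟩ : Fin l) ∈ s) ∧
        0 < q ∧ ∃ h : q - 1 < l, (⟨q - 1, h⟩ : Fin l) ∈ s).card := by
  have hβ' : ∀ r, 0 < β r := fun r => lt_of_lt_of_le two_pos (hβ r)
  have hD := isSkewShape_connectedRibbon hβ'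
  have hpair : ∀ (r r' : Fin l) (j : ℕ), r < r' → ribbonLo β r ≤ j → j < ribbonHi β r' →
      (r' : ℕ) = r + 1 ∧ ribbonLo β r = j := by
    intro r r' j hr h1 h2
    have hlt := Fin.lt_def.1 hr
    have hl := r'.2
    have h3 := ribbonHi_succ hβ' (r := r) (by omega)
    rcases (Nat.succ_le_of_lt hlt).eq_or_lt with h | h
    · have h4 : (r' : ℕ) = r + 1 := h.symm
      rw [h4] at h2
      omega
    · have h4 := hD.hi_anti (Nat.succ_le_of_lt h)
      have h5 := ribbonHi_succ hβ' (r := r + 1) (by simp only [Nat.succ_eq_add_one] at h; omega)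
      -- An intermediate row of length at least two separates the columns of rows `r` and `r'`, so
      -- nonconsecutive rows share no column.
      have h6 := hβ ⟨r + 1, by omega⟩
      have h7 := ribbonLo_val (β := β) ⟨r + 1, by omega⟩
      have h8 := ribbonHi_val (β := β) ⟨r + 1, by omega⟩
      simp only [Nat.succ_eq_add_one] at h4 h7 h8
      omega
  -- Every column of length two is the first column of the upper row `q - 1` of a consecutive pair.
  refine (Finset.card_le_card (fun j hj => ?_)).trans
    (Finset.card_image_le (f := fun q => ribbonLo β (q - 1)))
  have hcard := (Finset.mem_filter.1 hj).2
  obtain ⟨⟨x1, x2⟩, hx, ⟨y1, y2⟩, hy, hxy⟩ := Finset.one_lt_card.1 (hcard.symm ▸ one_lt_two)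
  simp only [Finset.mem_filter, Finset.mem_biUnion, mem_ribbonRow] at hx hy
  obtain ⟨⟨r, hr, rfl, hx1, hx2⟩, rfl⟩ := hx
  obtain ⟨⟨r', hr', rfl, hy1, hy2⟩, rfl⟩ := hy
  simp only [Finset.mem_image, Finset.mem_filter, Finset.mem_range]
  rcases lt_trichotomy r r' with h | h | h
  · obtain ⟨h1, h2⟩ := hpair r r' y2 h hx1 hy2
    refine ⟨r', ⟨r'.2, ⟨r'.2, hr'⟩, by omega, ?_⟩, ?_⟩
    · simpa [h1] using hr
    · simpa [h1] using h2
  · exact absurd (by rw [h]) hxy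
  · obtain ⟨h1, h2⟩ := hpair r' r y2 h hy1 hx2
    refine ⟨r, ⟨r.2, ⟨r.2, hr⟩, by omega, ?_⟩, ?_⟩
    · simpa [h1] using hr'
    · simpa [h1] using h2

/-! ### Ranking the rows by length. -/

/-- `longerRows` comes from a strict total order on the rows, so its cardinality is a rank; the ties
are broken by position. -/
theorem card_longerRows_lt {r s : Fin l} (h : s ∈ longerRows β r) :
    (longerRows β s).card < (longerRows β r).card := by
  refine Finset.card_lt_card ⟨fun q hq => ?_, fun hsub => ?_⟩
  · simp only [longerRows, Finset.mem_filter, Finset.mem_univ, true_and, Fin.lt_def] at h hq ⊢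
    omega
  · have := hsub h
    simp [longerRows] at this

/-- The position of a row when the rows are put in decreasing length order. -/
theorem exists_rank_perm (β : Fin l → ℕ) :
    ∃ e : Equiv.Perm (Fin l), (∀ r, (e r : ℕ) = (longerRows β r).card) ∧
      Antitone (β ∘ e.symm) := by
  have hlt : ∀ r, (longerRows β r).card < l := fun r => by
    have h : (longerRows β r).card < (Finset.univ : Finset (Fin l)).card :=
      Finset.card_lt_card ⟨Finset.subset_univ _, fun h => by
        have := h (Finset.mem_univ r)
        simp [longerRows] at this⟩
    simpa using h
  have hinj : Function.Injective fun r : Fin l => (⟨_, hlt r⟩ : Fin l) := by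
    intro r s hrs
    simp only [Fin.mk.injEq] at hrs
    by_contra hne
    have : s ∈ longerRows β r ∨ r ∈ longerRows β s := by
      have : (r : ℕ) ≠ s := fun h => hne (Fin.ext h)
      simp only [longerRows, Finset.mem_filter, Finset.mem_univ, true_and, Fin.lt_def]
      omega
    rcases this with h | h <;> have := card_longerRows_lt h <;> omega
  refine ⟨Equiv.ofBijective _ (Finite.injective_iff_bijective.1 hinj), fun r => rfl, ?_⟩
  set e := Equiv.ofBijective _ (Finite.injective_iff_bijective.1 hinj)
  intro p q hpq
  by_contra hlt'
  have h1 : e.symm q ∈ longerRows β (e.symm p) := by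
    simp only [longerRows, Finset.mem_filter, Finset.mem_univ, true_and]
    exact Or.inl (not_le.1 hlt')
  have h2 := card_longerRows_lt h1
  have h3 : ∀ x, (longerRows β (e.symm x)).card = (x : ℕ) := fun x =>
    congrArg Fin.val (e.apply_symm_apply x)
  rw [h3, h3] at h2
  exact absurd (Fin.le_def.1 hpq) (not_le.2 h2)

theorem card_notMem_smallestRows (β : Fin l → ℕ) (i : Fin l) :
    (Finset.univ.filter fun r => r ∉ smallestRows β i).card = i := by
  obtain ⟨e, he, -⟩ := exists_rank_perm β
  refine Eq.trans ?_ (Fin.card_Iio i)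
  rw [← Finset.card_map e.toEmbedding]
  congr 1
  ext q
  simp only [smallestRows, Finset.mem_map_equiv, Finset.mem_filter, Finset.mem_univ, true_and,
    ← he, Equiv.apply_symm_apply, Finset.mem_Iio, Fin.lt_def, not_le]

theorem sum_smallestRows {α : Fin l → ℕ} (hα : Antitone α) (π : Equiv.Perm (Fin l)) (i : Fin l) :
    ∑ r ∈ smallestRows (α ∘ π) i, (α ∘ π) r = ∑ q ∈ Finset.Ici i, α q := by
  obtain ⟨e, he, hanti⟩ := exists_rank_perm (α ∘ π)
  -- Two decreasing rearrangements of the same family coincide, so the row of rank `q` has length `α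
  -- q` however ties are broken.
  have h : α ∘ (e.symm.trans π) = α ∘ (Equiv.refl (Fin l)) :=
    Tuple.unique_monotone (α := ℕᵒᵈ) (f := OrderDual.toDual ∘ α) (σ := e.symm.trans π)
      (τ := Equiv.refl _) (fun _ _ hpq => hanti hpq) (fun _ _ hpq => hα hpq)
  refine Finset.sum_equiv e (fun r => ?_) fun r _ => ?_
  · simp only [smallestRows, Finset.mem_filter, Finset.mem_univ, true_and, Finset.mem_Ici,
      Fin.le_def, he]
  · have := congrFun h (e r)
    simpa using this

end Ribbon

/-! ### The bound on the parts of `ν`. -/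

/-- Indices start from `0`: `α i`, `overlappingPartition (α ∘ π) i` and `ν.rowLen i` are the
parts number `i + 1` of `α`, `p^π` and `ν`. -/
theorem theorem6 (l : ℕ) (α : Fin l → ℕ) (hα : Antitone α) (hα2 : ∀ i, 2 ≤ α i)
    (π : Equiv.Perm (Fin l)) (ν : YoungDiagram)
    (hν : 0 < lrCoeff (connectedRibbon (α ∘ π)) ν)
    (i : Fin l) (hi : (i : ℕ) < partitionLength (overlappingPartition (α ∘ π))) :
    (ν.rowLen i : ℤ) ≤
      (∑ q ∈ Finset.Ici i, (α q : ℤ)) - (overlappingPartition (α ∘ π) i : ℤ) := by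
  classical
  have hβ : ∀ r, 2 ≤ (α ∘ π) r := fun r => hα2 (π r)
  have hsum := sum_smallestRows hα π i
  generalize α ∘ π = β at *
  have hβ' : ∀ r, 0 < β r := fun r => lt_of_lt_of_le two_pos (hβ r)
  -- The alphabet size is at least the number of rows of `ν`, for duality, and exceeds `i < l`, so
  -- that the content formula applies to the letter `i`.
  obtain ⟨b, hb, hg, hc⟩ := exists_good_of_lrCoeff_pos (n := ν.colLen 0 + l)
    (isSkewShape_connectedRibbon hβ') (Nat.le_add_right _ _) hν
  set s := smallestRows β i with hs
  obtain ⟨kept, hkept⟩ : ∃ kept : ℕ → Prop, ∀ q, kept q ↔ ∃ h : q < l, (⟨q, h⟩ : Fin l) ∈ s :=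
    ⟨_, fun _ => Iff.rfl⟩
  have hkv : ∀ r : Fin l, kept r ↔ r ∈ s := fun r => by simp [hkept]
  have hdel : ((Finset.range l).filter fun q => ¬ kept q).card = i := by
    rw [← card_notMem_smallestRows β i, Finset.card_filter, Finset.card_filter,
      Finset.sum_range]
    exact Finset.sum_congr rfl fun r _ => by simp only [hkv, hs]
  -- Over the whole ribbon exactly `i` rows are deleted, so the letter being counted is `i` and its
  -- number is `ν.rowLen i`.
  have h1 := (hg.letterCount_le_sum_newColumns hb (fun r hr => ribbonHi_succ hβ' hr)
    kept l le_rfl).1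
  rw [hdel, hc i (by omega)] at h1
  have h2 : ∑ q ∈ Finset.range l, newColumns (ribbonLo β) (ribbonHi β) kept q =
      ∑ r ∈ s, (β r : ℤ) -
        ((Finset.range l).filter fun q => kept q ∧ 0 < q ∧ kept (q - 1)).card := by
    have h3 : ∑ r ∈ s, (β r : ℤ) = ∑ q ∈ Finset.range l,
        if kept q then (ribbonHi β q : ℤ) - ribbonLo β q else 0 := by
      rw [Finset.sum_range, ← Finset.sum_filter]
      refine Finset.sum_congr ?_ fun r _ => ?_
      · ext r
        simp [hkv]
      · rw [ribbonHi_val, ribbonLo_val]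
        push_cast
        ring
    rw [h3, Finset.card_filter]
    push_cast
    rw [← Finset.sum_sub_distrib]
    refine Finset.sum_congr rfl fun q _ => ?_
    unfold newColumns
    by_cases hq : kept q <;> simp [hq]
  have h4 : overlappingPartition β i ≤
      ((Finset.range l).filter fun q => kept q ∧ 0 < q ∧ kept (q - 1)).card :=
    (numColumnsTwo_biUnion_ribbonRow_le hβ s).trans
      (Finset.card_le_card fun q hq => by simpa only [Finset.mem_filter, hkept] using hq)
  have h5 : ∑ r ∈ s, (β r : ℤ) = ∑ q ∈ Finset.Ici i, (α q : ℤ) := by exact_mod_cast hsum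
  rw [← h5]
  omega
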